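/- Let $V$ be a finite-dimensional real inner product space and let $W \subset \mathrm{O}(V)$ be a finite group generated by orthogonal reflections at hyperplanes. Suppose that $W$ is almost irreducible, i.e. $V = V_1 \oplus V_2$ with $W$-invariant subspaces $V_1, V_2$ such that $W$ acts irreducibly and nontrivially on $V_1$ and trivially on $V_2$, and $\dim V_2 = 1$. Let $C \subset V$ be a monoconditional symmetric cone, i.e. a $W$-invariant convex polyhedral cone for which there is a linear form $\phi \in V^*$ with $V_1 \not\subset \ker\phi$, $V_2 \not\subset \ker \phi$ and \[ C = \{ x \in V \mid \forall \sigma \in W : \phi(\sigma x) \geq 0 \}. \tag{1} \] Let $F \subset V$ be a fundamental domain for $W$, i.e. the closure of an open subset of $V$ that meets each $W$-orbit in exactly one point. Then: (a) $C_+ := C \cap F$ is a simplicial cone, i.e. it is generated by a finite linearly independent set of vectors. (b) For every linear form $\phi$ with $V_1 \not\subset \ker\phi$ and $V_2 \not\subset \ker \phi$ that satisfies (1), let $x_\phi \in V$ be the vector with $\phi(x) = -(x, x_\phi)$ for all $x \in V$, and let $x_0$ be the unique element of $W x_\phi \cap F$. Then $C_+ = \{ x \in F \mid (x, x_0) \leq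 0 \}$. (c) $C = \bigcup_{\sigma \in W} \sigma C_+$, and this is a triangulation of $C$: the set of all faces of the cones $\sigma C_+$, $\sigma \in W$, is a finite set of simplicial cones with union $C$ that is closed under taking faces, and any two of its members intersect in a common face of both. -/

import Mathlib

namespace ReflCone

variable {V : Type*} [NormedAddCommGroup V] [InnerProductSpace ℝ V]

/-- `s` is the orthogonal reflection at the hyperplane orthogonal to some nonzero vector. -/
def IsHyperplaneReflection (s : V ≃ₗᵢ[ℝ] V) : Prop :=
  ∃ v : V, v ≠ 0 ∧ s = (ℝ ∙ v)ᗮ.reflection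

/-- A finite reflection group: a finite subgroup of `O(V)` generated by reflections. -/
def IsFiniteReflectionGroup (W : Subgroup (V ≃ₗᵢ[ℝ] V)) : Prop :=
  Finite W ∧ ∃ S : Set (V ≃ₗᵢ[ℝ] V), (∀ s ∈ S, IsHyperplaneReflection s) ∧ Subgroup.closure S = W

def IsInvariantSubspace (W : Subgroup (V ≃ₗᵢ[ℝ] V)) (U : Submodule ℝ V) : Prop :=
  ∀ σ ∈ W, ∀ x ∈ U, σ x ∈ U

/-- `W` is an almost irreducible finite reflection group, with decomposition `V = V₁ ⊕ V₂`. -/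
structure IsAlmostIrreducible (W : Subgroup (V ≃ₗᵢ[ℝ] V)) (V₁ V₂ : Submodule ℝ V) : Prop where
  reflectionGroup : IsFiniteReflectionGroup W
  isCompl : IsCompl V₁ V₂
  invariant_left : IsInvariantSubspace W V₁
  invariant_right : IsInvariantSubspace W V₂
  ne_bot : V₁ ≠ ⊥
  irreducible : ∀ U : Submodule ℝ V, U ≤ V₁ → IsInvariantSubspace W U → U = ⊥ ∨ U = V₁
  nontrivial : ∃ σ ∈ W, ∃ x ∈ V₁, σ x ≠ x
  trivial : ∀ σ ∈ W, ∀ x ∈ V₂, σ x = x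
  finrank_eq_one : Module.finrank ℝ V₂ = 1

/-- The orbit of `x` under `W`. -/
def orbit (W : Subgroup (V ≃ₗᵢ[ℝ] V)) (x : V) : Set V := {y | ∃ σ ∈ W, y = σ x}

/-- `F` is the closure of an open set and meets every `W`-orbit in exactly one point. -/
def IsFundamentalDomain (W : Subgroup (V ≃ₗᵢ[ℝ] V)) (F : Set V) : Prop :=
  (∃ U : Set V, IsOpen U ∧ F = closure U) ∧ ∀ x : V, ∃! y : V, y ∈ orbit W x ∧ y ∈ F

/-- A convex polyhedral cone: the solution set of finitely many homogeneous linear inequalities. -/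
def IsPolyhedral (C : PointedCone ℝ V) : Prop :=
  ∃ S : Finset (Module.Dual ℝ V), ∀ x : V, x ∈ C ↔ ∀ f ∈ S, 0 ≤ f x

/-- The image `σ C` of a cone under an orthogonal map. -/
def translate (σ : V ≃ₗᵢ[ℝ] V) (C : PointedCone ℝ V) : PointedCone ℝ V :=
  C.map (σ.toLinearEquiv : V →ₗ[ℝ] V)

/-- A symmetric cone: a convex polyhedral cone invariant under `W`. -/
def IsSymmetricCone (W : Subgroup (V ≃ₗᵢ[ℝ] V)) (C : PointedCone ℝ V) : Prop :=
  IsPolyhedral C ∧ ∀ σ ∈ W, translate σ C = C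

/-- The linear form `φ` exhibits the cone `C` as monoconditional. -/
structure IsDefiningForm (W : Subgroup (V ≃ₗᵢ[ℝ] V)) (V₁ V₂ : Submodule ℝ V)
    (C : PointedCone ℝ V) (φ : Module.Dual ℝ V) : Prop where
  not_le_left : ¬ V₁ ≤ LinearMap.ker φ
  not_le_right : ¬ V₂ ≤ LinearMap.ker φ
  mem_iff : ∀ x : V, x ∈ C ↔ ∀ σ ∈ W, 0 ≤ φ (σ x)

/-- A monoconditional symmetric cone. -/
def IsMonoconditional (W : Subgroup (V ≃ₗᵢ[ℝ] V)) (V₁ V₂ : Submodule ℝ V)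
    (C : PointedCone ℝ V) : Prop :=
  IsSymmetricCone W C ∧ ∃ φ : Module.Dual ℝ V, IsDefiningForm W V₁ V₂ C φ

/-- `T` is a triangulation of the cone `C`: a finite set of simplicial cones with union `C`,
closed under taking faces, any two of which intersect in a common face. -/
structure IsTriangulation (C : PointedCone ℝ V) (T : Set (PointedCone ℝ V)) : Prop where
  finite : T.Finite
  simplicial : ∀ G ∈ T, G.IsSimplicial
  face_mem : ∀ G ∈ T, ∀ G' : PointedCone ℝ V, G'.IsFaceOf G → G' ∈ T
  inter_face : ∀ G ∈ T, ∀ G' ∈ T, (G ⊓ G').IsFaceOf G ∧ (G ⊓ G').IsFaceOf G'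
  union : (C : Set V) = ⋃ G ∈ T, (G : Set V)

end ReflCone

/-!
The folding map `V → F`, which sends a vector to the representative of its orbit, is locally given
by elements of `W`, so it is `1`-Lipschitz. Hence `⟪x, σ y⟫ ≤ ⟪x, y⟫` for `x y ∈ F` and `σ ∈ W`,
and `F` is the Dirichlet domain of any of its interior points `p`: the dual cone of the vectors
`p - σ p`. In an irredundant set of such normals every `u = p - σ p` supports a facet, so `σ` is the
reflection in that facet. If `y` and `z` are interior points of two facets, with reflections `σ`
and `τ`, then `⟪τ y, σ z⟫ ≤ ⟪y, z⟫` says exactly that the two normals form a non-acute angle.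
Vectors in an open half-space with pairwise non-acute angles are linearly independent.

The lineality space of `F` is the fixed space `V^W`, which is a line not contained in the kernel of
`φ`. On `F` the condition `φ (σ x) ≥ 0` for all `σ` reduces to the single inequality
`⟪x, -x₀⟫ ≥ 0`. Since `φ` does not vanish on `V^W`, the vector `-x₀` completes the normals of `F` to
a basis of `V`, so `C ∩ F` is dual to a basis and thus simplicial.
-/

namespace ReflCone

open Filter Topology
open scoped RealInnerProductSpace

section Analysis

theorem lipschitzWith_of_eventually_dist_le {E X : Type*} [NormedAddCommGroup E] [NormedSpace ℝ E]
    [PseudoMetricSpace X] {f : E → X} {K : NNReal}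
    (hf : ∀ x, ∀ᶠ y in 𝓝 x, dist (f y) (f x) ≤ K * dist y x) : LipschitzWith K f := by
  have hcont : Continuous f := continuous_iff_continuousAt.2 fun x => by
    refine tendsto_iff_dist_tendsto_zero.2
      (squeeze_zero' (Eventually.of_forall fun _ => dist_nonneg) (hf x) ?_)
    exact (by fun_prop : Continuous fun y => K * dist y x).tendsto' x 0 (by simp)
  refine LipschitzWith.of_dist_le_mul fun y x => ?_
  let γ : ℝ → E := AffineMap.lineMap x y
  have hγ : Continuous γ := AffineMap.lineMap_continuous
  have hdist (t r : ℝ) (htr : t ≤ r) : dist (γ r) (γ t) = (r - t) * dist y x := by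
    rw [dist_lineMap_lineMap, Real.dist_eq, abs_of_nonneg (sub_nonneg.2 htr), dist_comm x]
  suffices h : Set.Icc 0 1 ⊆ {t | dist (f (γ t)) (f x) ≤ K * (t * dist y x)} by
    simpa [γ] using h (Set.right_mem_Icc.2 zero_le_one)
  refine IsClosed.Icc_subset_of_forall_mem_nhdsWithin ?_ (by simp [γ]) fun t ht => ?_
  · exact (isClosed_le (by fun_prop) (by fun_prop)).inter isClosed_Icc
  · filter_upwards [(hγ.tendsto t).eventually (hf (γ t)) |>.filter_mono nhdsWithin_le_nhds,
      self_mem_nhdsWithin] with r hr htr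
    calc dist (f (γ r)) (f x)
      _ ≤ dist (f (γ r)) (f (γ t)) + dist (f (γ t)) (f x) := dist_triangle _ _ _
      _ ≤ K * ((r - t) * dist y x) + K * (t * dist y x) :=
        add_le_add (hdist t r (le_of_lt htr) ▸ hr) ht.1
      _ = K * (r * dist y x) := by ring

theorem eq_zero_of_inner_nonneg_of_mem_interior {V : Type*} [NormedAddCommGroup V]
    [InnerProductSpace ℝ V] {s : Set V} {p w : V} (hp : p ∈ interior s)
    (hs : ∀ z ∈ s, 0 ≤ ⟪z, w⟫) (hpw : ⟪p, w⟫ = 0) : w = 0 := by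
  have hmin : IsLocalMin (innerSL ℝ w) p := by
    filter_upwards [mem_interior_iff_mem_nhds.1 hp] with z hz
    rw [innerSL_apply_apply, innerSL_apply_apply, real_inner_comm p, real_inner_comm z, hpw]
    exact hs z hz
  have hzero : innerSL ℝ w = 0 := hmin.hasFDerivAt_eq_zero (innerSL ℝ w).hasFDerivAt
  exact inner_self_eq_zero.1 (congrArg (· w) hzero)

end Analysis

section DualCone

variable {R M N : Type*} [AddCommGroup M] [AddCommGroup N]

/-- `y` lies in the relative interior of the facet of the dual cone of `t` supported by `u`, and in
no other facet. The point `y` is in `PointedCone.dual p t` by `IsFacetPoint.mem_dual`. -/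
def IsFacetPoint [CommRing R] [LinearOrder R] [Module R M] [Module R N] (p : M →ₗ[R] N →ₗ[R] R)
    (t : Set M) (u : M) (y : N) : Prop :=
  p u y = 0 ∧ ∀ v ∈ t, v ≠ u → 0 < p v y

section Ring

variable [CommRing R] [LinearOrder R] [IsStrictOrderedRing R] [Module R M] [Module R N]
  {p : M →ₗ[R] N →ₗ[R] R} {t : Set M} {u : M} {y : N}

theorem IsFacetPoint.mem_dual (hy : IsFacetPoint p t u y) : y ∈ PointedCone.dual p t := by
  intro v hv
  obtain rfl | hvu := eq_or_ne v u
  exacts [hy.1.ge, (hy.2 v hv hvu).le]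

theorem exists_isFacetPoint_of_dual_ne {y₀ : N} (hy₀ : ∀ v ∈ t, 0 < p v y₀) (hu : u ∈ t)
    (hne : PointedCone.dual p (t \ {u}) ≠ PointedCone.dual p t) : ∃ y, IsFacetPoint p t u y := by
  obtain ⟨y, hy, hyt⟩ :=
    SetLike.exists_of_lt ((PointedCone.dual_anti Set.sdiff_subset).lt_of_ne' hne)
  have hy' : ∀ v ∈ t, v ≠ u → 0 ≤ p v y := fun v hv hvu => hy ⟨hv, hvu⟩
  have huy : p u y < 0 := by
    by_contra! h
    refine hyt fun v hv => ?_
    obtain rfl | hvu := eq_or_ne v u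
    exacts [h, hy' v hv hvu]
  -- The segment from `y₀` to `y` meets the hyperplane `p u = 0` in a multiple of this vector.
  refine ⟨p u y₀ • y - p u y • y₀, ?_, fun v hv hvu => ?_⟩ <;>
    simp only [map_sub, map_smul, smul_eq_mul]
  · ring
  · linarith [mul_nonneg (hy₀ u hu).le (hy' v hv hvu), mul_neg_of_neg_of_pos huy (hy₀ v hv)]

theorem exists_subset_dual_eq_forall_exists_isFacetPoint {s : Set M} (hs : s.Finite) {y₀ : N}
    (hy₀ : ∀ v ∈ s, 0 < p v y₀) :
    ∃ t ⊆ s, PointedCone.dual p t = PointedCone.dual p s ∧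
      ∀ u ∈ t, ∃ y, IsFacetPoint p t u y := by
  obtain ⟨t, ⟨hts, ht⟩, hmin⟩ := (hs.finite_subsets.subset fun _ h => h.1).exists_minimal
    (⟨s, subset_rfl, rfl⟩ : {t | t ⊆ s ∧ PointedCone.dual p t = PointedCone.dual p s}.Nonempty)
  refine ⟨t, hts, ht, fun u hu => exists_isFacetPoint_of_dual_ne (fun v hv => hy₀ v (hts hv)) hu
    fun heq => ?_⟩
  exact (hmin ⟨Set.sdiff_subset.trans hts, heq.trans ht⟩ Set.sdiff_subset hu).2 rfl

theorem isSimplicial_dual [p.IsPerfPair] (ht : t.Finite) (hli : LinearIndepOn R id t)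
    (hspan : Submodule.span R t = ⊤) : (PointedCone.dual p t).IsSimplicial := by
  classical
  have := ht.to_subtype
  have := Fintype.ofFinite t
  let b : Module.Basis t R M := .mk hli (by simp [hspan])
  let d : Module.Basis t R N := b.dualBasis.map p.flip.toPerfPair.symm
  have hd (y : N) (i : t) : d.repr y i = p i y := by simp [d, b]
  refine ⟨Set.range d, Set.finite_range d, d.linearIndependent.linearIndepOn_id, ?_⟩
  refine le_antisymm (Submodule.span_le.2 ?_) fun y hy => ?_
  · rintro _ ⟨j, rfl⟩ v hv
    rw [← hd _ ⟨v, hv⟩, d.repr_self]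
    exact Finsupp.single_nonneg.2 zero_le_one _
  · rw [← d.sum_repr y]
    refine Submodule.sum_mem _ fun i _ => PointedCone.smul_mem _ ?_
      (PointedCone.subset_hull ⟨i, rfl⟩)
    exact hd y i ▸ hy i.2

end Ring

theorem IsFacetPoint.eventually_add_smul_mem_dual [Field R] [LinearOrder R] [IsStrictOrderedRing R]
    [Module R M] [Module R N] {p : M →ₗ[R] N →ₗ[R] R} {t : Set M} {u : M} {y z : N}
    (hy : IsFacetPoint p t u y) (ht : t.Finite) (hz : p u z = 0) :
    ∀ᶠ c : R in atTop, z + c • y ∈ PointedCone.dual p t := by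
  refine (eventually_all_finite ht).2 fun v hv => ?_
  simp only [map_add, map_smul, smul_eq_mul]
  obtain rfl | hvu := eq_or_ne v u
  · simp [hy.1, hz]
  · exact (tendsto_atTop_add_const_left _ _
      (tendsto_id.atTop_mul_const (hy.2 v hv hvu))).eventually_ge_atTop 0

end DualCone

section Simplicial

variable {R M N : Type*}

section Ring

variable [Semiring R] [PartialOrder R] [IsOrderedRing R] [AddCommGroup M] [Module R M]
  [AddCommGroup N] [Module R N]

theorem hull_inter_eq_of_isFaceOf {s : Set M} {G : PointedCone R M}
    (hG : G.IsFaceOf (PointedCone.hull R s)) : PointedCone.hull R (s ∩ G) = G := by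
  refine le_antisymm (Submodule.span_le.2 Set.inter_subset_right) fun x hx => ?_
  obtain ⟨c, hcs, hc, rfl⟩ := PointedCone.mem_hull_set.1 (hG.le hx)
  refine Submodule.sum_mem _ fun i hi => PointedCone.smul_mem _ (hc i) ?_
  refine PointedCone.subset_hull ⟨hcs hi, ?_⟩
  rw [Finsupp.sum, ← Finset.sum_coe_sort] at hx
  exact hG.mem_of_sum_smul_mem (f := fun j : c.support => (j : M))
    (fun j => PointedCone.subset_hull (hcs j.2)) (fun j => hc j) hx ⟨i, hi⟩
    ((hc i).lt_of_ne' (Finsupp.mem_support_iff.1 hi))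

theorem isSimplicial_of_isFaceOf {G K : PointedCone R M} (hK : K.IsSimplicial)
    (hG : G.IsFaceOf K) : G.IsSimplicial := by
  obtain ⟨s, hs, hli, rfl⟩ := hK
  exact ⟨s ∩ G, hs.inter_of_left _, hli.mono Set.inter_subset_left, hull_inter_eq_of_isFaceOf hG⟩

theorem finite_setOf_isFaceOf {K : PointedCone R M} (hK : K.IsSimplicial) :
    {G : PointedCone R M | G.IsFaceOf K}.Finite := by
  obtain ⟨s, hs, -, rfl⟩ := hK
  exact (hs.powerset.image (PointedCone.hull R)).subset fun G hG =>
    ⟨s ∩ G, Set.inter_subset_left, hull_inter_eq_of_isFaceOf hG⟩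

theorem isSimplicial_map {K : PointedCone R M} (hK : K.IsSimplicial) {f : M →ₗ[R] N}
    (hf : Function.Injective f) : (K.map f).IsSimplicial := by
  obtain ⟨s, hs, hli, rfl⟩ := hK
  exact ⟨f '' s, hs.image _, hli.id_imageₛ hf.injOn,
    (Submodule.map_span (f.restrictScalars _) s).symm⟩

end Ring

end Simplicial

variable {V : Type*} [NormedAddCommGroup V] [InnerProductSpace ℝ V]
  {W : Subgroup (V ≃ₗᵢ[ℝ] V)} {C : PointedCone ℝ V} {F : Set V}

theorem inner_apply_left (σ : V ≃ₗᵢ[ℝ] V) (x y : V) : ⟪σ x, y⟫ = ⟪x, σ⁻¹ y⟫ :=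
  σ.inner_map_eq_flip x y

theorem inner_sub_apply_self (σ : V ≃ₗᵢ[ℝ] V) (p : V) : ⟪p, p - σ p⟫ = ‖p - σ p‖ ^ 2 / 2 := by
  rw [norm_sub_sq_real, σ.norm_map, inner_sub_right, real_inner_self_eq_norm_sq]
  ring

/-- The subspace `V^W` of vectors fixed by every element of `W`. -/
def fixedSubmodule (W : Subgroup (V ≃ₗᵢ[ℝ] V)) : Submodule ℝ V where
  carrier := {x | ∀ σ ∈ W, σ x = x}
  add_mem' hx hy σ hσ := by rw [map_add, hx σ hσ, hy σ hσ]
  zero_mem' σ _ := map_zero σ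
  smul_mem' c x hx σ hσ := by rw [map_smul, hx σ hσ]

namespace IsFundamentalDomain

theorem isClosed (hF : IsFundamentalDomain W F) : IsClosed F := by
  obtain ⟨⟨U, -, rfl⟩, -⟩ := hF
  exact isClosed_closure

theorem exists_apply_mem (hF : IsFundamentalDomain W F) (x : V) : ∃ σ ∈ W, σ x ∈ F := by
  obtain ⟨_, ⟨⟨σ, hσ, rfl⟩, h⟩, -⟩ := hF.2 x
  exact ⟨σ, hσ, h⟩

theorem apply_eq_apply (hF : IsFundamentalDomain W F) {σ τ : V ≃ₗᵢ[ℝ] V} (hσ : σ ∈ W) (hτ : τ ∈ W)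
    {x : V} (hσx : σ x ∈ F) (hτx : τ x ∈ F) : σ x = τ x :=
  (hF.2 x).unique ⟨⟨σ, hσ, rfl⟩, hσx⟩ ⟨⟨τ, hτ, rfl⟩, hτx⟩

theorem apply_eq_self (hF : IsFundamentalDomain W F) {σ : V ≃ₗᵢ[ℝ] V} (hσ : σ ∈ W) {x : V}
    (hx : x ∈ F) (hσx : σ x ∈ F) : σ x = x :=
  hF.apply_eq_apply hσ W.one_mem hσx hx

theorem nonempty_interior (hF : IsFundamentalDomain W F) : (interior F).Nonempty := by
  obtain ⟨σ, -, hσ⟩ := hF.exists_apply_mem 0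
  obtain ⟨⟨U, hU, rfl⟩, -⟩ := hF
  exact (closure_nonempty_iff.1 ⟨_, hσ⟩).mono hU.subset_interior_closure

theorem orbit_inter_eq_singleton (hF : IsFundamentalDomain W F) {σ : V ≃ₗᵢ[ℝ] V} (hσ : σ ∈ W)
    {x : V} (hσx : σ x ∈ F) : orbit W x ∩ F = {σ x} :=
  Set.eq_singleton_iff_unique_mem.2
    ⟨⟨⟨σ, hσ, rfl⟩, hσx⟩, fun _ hy => (hF.2 x).unique hy ⟨⟨σ, hσ, rfl⟩, hσx⟩⟩

/-- The folding map `V → F`, which sends a vector to the representative of its orbit in `F`. -/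
noncomputable def fold (hF : IsFundamentalDomain W F) (x : V) : V := (hF.2 x).choose

theorem fold_eq (hF : IsFundamentalDomain W F) {σ : V ≃ₗᵢ[ℝ] V} (hσ : σ ∈ W) {x : V}
    (hσx : σ x ∈ F) : hF.fold x = σ x :=
  ((hF.2 x).choose_spec.2 _ ⟨⟨σ, hσ, rfl⟩, hσx⟩).symm

section Finite

variable [Finite W]

theorem eventually_apply_mem_imp (hF : IsFundamentalDomain W F) (x : V) :
    ∀ᶠ y in 𝓝 x, ∀ σ ∈ W, σ y ∈ F → σ x ∈ F := by
  have h (σ : W) : ∀ᶠ y in 𝓝 x, (σ : V ≃ₗᵢ[ℝ] V) y ∈ F → (σ : V ≃ₗᵢ[ℝ] V) x ∈ F := by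
    by_cases hx : (σ : V ≃ₗᵢ[ℝ] V) x ∈ F
    · exact .of_forall fun _ _ => hx
    · filter_upwards [(hF.isClosed.preimage (σ : V ≃ₗᵢ[ℝ] V).continuous).isOpen_compl.mem_nhds hx]
        with y hy hyF using absurd hyF hy
  simpa only [Subtype.forall] using eventually_all.2 h

theorem lipschitzWith_fold (hF : IsFundamentalDomain W F) : LipschitzWith 1 hF.fold := by
  refine lipschitzWith_of_eventually_dist_le fun x => ?_
  filter_upwards [hF.eventually_apply_mem_imp x] with y hy
  obtain ⟨σ, hσ, hσy⟩ := hF.exists_apply_mem y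
  rw [hF.fold_eq hσ hσy, hF.fold_eq hσ (hy σ hσ hσy), σ.dist_map, NNReal.coe_one, one_mul]

theorem inner_apply_le (hF : IsFundamentalDomain W F) {x y : V} (hx : x ∈ F) (hy : y ∈ F)
    {σ : V ≃ₗᵢ[ℝ] V} (hσ : σ ∈ W) : ⟪x, σ y⟫ ≤ ⟪x, y⟫ := by
  have hfold : hF.fold (σ y) = y := by
    have h : σ⁻¹ (σ y) = y := σ.symm_apply_apply y
    rw [hF.fold_eq (W.inv_mem hσ) (h.symm ▸ hy), h]
  have hle : ‖x - y‖ ≤ ‖x - σ y‖ := by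
    simpa [dist_eq_norm, hF.fold_eq W.one_mem hx, hfold] using
      hF.lipschitzWith_fold.dist_le_mul x (σ y)
  have hsq := pow_le_pow_left₀ (norm_nonneg _) hle 2
  rw [norm_sub_sq_real, norm_sub_sq_real, σ.norm_map] at hsq
  linarith

theorem apply_eq_self_of_inner_sub_eq_zero (hF : IsFundamentalDomain W F) {p x : V}
    (hp : p ∈ interior F) (hx : x ∈ F) {σ : V ≃ₗᵢ[ℝ] V} (hσ : σ ∈ W)
    (h : ⟪x, p - σ p⟫ = 0) : σ x = x := by
  have hzero : x - σ⁻¹ x = 0 := by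
    refine eq_zero_of_inner_nonneg_of_mem_interior hp (fun z hz => ?_) ?_
    · rw [inner_sub_right, sub_nonneg]
      exact hF.inner_apply_le hz hx (W.inv_mem hσ)
    · rw [inner_sub_right, ← inner_apply_left, ← inner_sub_left, real_inner_comm, h]
  exact (σ.symm_apply_eq.1 (sub_eq_zero.1 hzero).symm).symm

theorem mem_iff_forall_inner_apply_le (hF : IsFundamentalDomain W F) {p : V}
    (hp : p ∈ interior F) {x : V} : x ∈ F ↔ ∀ σ ∈ W, ⟪x, σ p⟫ ≤ ⟪x, p⟫ := by
  refine ⟨fun hx σ hσ => hF.inner_apply_le hx (interior_subset hp) hσ, fun hx => ?_⟩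
  obtain ⟨σ, hσ, hσx⟩ := hF.exists_apply_mem x
  have hσi := W.inv_mem hσ
  have hle : ⟪p, x⟫ ≤ ⟪p, σ x⟫ := by
    simpa using hF.inner_apply_le (interior_subset hp) hσx hσi
  have hge : ⟪σ x, p⟫ ≤ ⟪x, p⟫ := inner_apply_left σ x p ▸ hx σ⁻¹ hσi
  have hfix : σ (σ x) = σ x := by
    refine hF.apply_eq_self_of_inner_sub_eq_zero hp hσx hσ ?_
    rw [inner_sub_right, σ.inner_map_map]
    rw [real_inner_comm x p, real_inner_comm (σ x) p] at hle
    linarith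
  rwa [σ.injective hfix] at hσx

theorem apply_eq_self_of_apply_add (hF : IsFundamentalDomain W F) {x y : V} (hx : x ∈ F)
    (hy : y ∈ F) {σ : V ≃ₗᵢ[ℝ] V} (hσ : σ ∈ W) (h : σ (x + y) = x + y) : σ x = x := by
  obtain ⟨p, hp⟩ := hF.nonempty_interior
  refine hF.apply_eq_self_of_inner_sub_eq_zero hp hx hσ ?_
  have hsum : ⟪x + y, p - σ p⟫ = 0 := by
    rw [inner_sub_right, ← congrArg (⟪·, σ p⟫) h, σ.inner_map_map, sub_self]
  have hxp := (hF.mem_iff_forall_inner_apply_le hp).1 hx σ hσ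
  have hyp := (hF.mem_iff_forall_inner_apply_le hp).1 hy σ hσ
  simp only [inner_add_left, inner_sub_right] at hsum hxp hyp ⊢
  linarith

theorem mem_fixedSubmodule_iff (hF : IsFundamentalDomain W F) {x : V} :
    x ∈ fixedSubmodule W ↔ x ∈ F ∧ -x ∈ F := by
  constructor
  · intro hx
    obtain ⟨σ, hσ, hσx⟩ := hF.exists_apply_mem x
    obtain ⟨τ, hτ, hτx⟩ := hF.exists_apply_mem (-x)
    rw [map_neg, hx τ hτ] at hτx
    exact ⟨hx σ hσ ▸ hσx, hτx⟩
  · rintro ⟨hx, hx'⟩ σ hσ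
    exact hF.apply_eq_self_of_apply_add hx hx' hσ (by rw [add_neg_cancel, map_zero])

end Finite

end IsFundamentalDomain

/-- The nonzero vectors `p - σ p` with `σ ∈ W`. Those `x` whose inner product with each of them is
nonnegative form the Dirichlet domain `{x | ∀ σ ∈ W, ‖x - p‖ ≤ ‖x - σ p‖}` of `p`. -/
def dirichletNormals (W : Subgroup (V ≃ₗᵢ[ℝ] V)) (p : V) : Set V :=
  {u | u ≠ 0 ∧ ∃ σ ∈ W, u = p - σ p}

theorem finite_dirichletNormals [Finite W] (p : V) : (dirichletNormals W p).Finite :=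
  (Set.finite_range fun σ : W => p - (σ : V ≃ₗᵢ[ℝ] V) p).subset
    fun _ ⟨_, σ, hσ, h⟩ => ⟨⟨σ, hσ⟩, h.symm⟩

theorem inner_pos_of_mem_dirichletNormals {p u : V} (hu : u ∈ dirichletNormals W p) :
    0 < ⟪u, p⟫ := by
  obtain ⟨hne, σ, -, rfl⟩ := hu
  rw [real_inner_comm, inner_sub_apply_self]
  exact half_pos (pow_pos (norm_pos_iff.2 hne) 2)

namespace IsFundamentalDomain

variable [Finite W]

theorem coe_dual_dirichletNormals (hF : IsFundamentalDomain W F) {p : V} (hp : p ∈ interior F) :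
    (PointedCone.dual (innerₗ V) (dirichletNormals W p) : Set V) = F := by
  ext x
  rw [SetLike.mem_coe, PointedCone.mem_dual, hF.mem_iff_forall_inner_apply_le hp]
  have hsub (σ : V ≃ₗᵢ[ℝ] V) : ⟪p - σ p, x⟫ = ⟪x, p⟫ - ⟪x, σ p⟫ := by
    rw [real_inner_comm, inner_sub_right]
  refine ⟨fun h σ hσ => ?_, ?_⟩
  · by_cases hfix : p - σ p = 0
    · rw [← sub_eq_zero.1 hfix]
    · exact sub_nonneg.1 ((h ⟨hfix, σ, hσ, rfl⟩).trans_eq (hsub σ))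
  · rintro h _ ⟨-, σ, hσ, rfl⟩
    exact (sub_nonneg.2 (h σ hσ)).trans_eq (hsub σ).symm

section Facets

variable {p : V} {t : Set V}

theorem apply_eq_sub_smul_of_isFacetPoint (hF : IsFundamentalDomain W F) (hp : p ∈ interior F)
    (ht : t.Finite) (hdual : (PointedCone.dual (innerₗ V) t : Set V) = F) {σ : V ≃ₗᵢ[ℝ] V}
    (hσ : σ ∈ W) {y : V} (hy : IsFacetPoint (innerₗ V) t (p - σ p) y) (hpos : 0 < ⟪p - σ p, p⟫)
    (z : V) : σ z = z - (⟪p - σ p, z⟫ / ⟪p - σ p, p⟫) • (p - σ p) := by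
  have hwall (x : V) (hx : x ∈ F) (hpx : ⟪p - σ p, x⟫ = 0) : σ x = x :=
    hF.apply_eq_self_of_inner_sub_eq_zero hp hx hσ (real_inner_comm x _ ▸ hpx)
  have hy₀ : ⟪p - σ p, y⟫ = 0 := hy.1
  -- `y` absorbs vectors of the hyperplane: `σ` fixes `x + c • y` and `y`, hence `x`.
  have hperp (x : V) (hx : ⟪p - σ p, x⟫ = 0) : σ x = x := by
    obtain ⟨c, hc⟩ := (hy.eventually_add_smul_mem_dual ht hx).exists
    have hadd : σ (x + c • y) = x + c • y := hwall _ (hdual.subset hc) <| by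
      rw [inner_add_right, real_inner_smul_right, hx, hy₀, mul_zero, add_zero]
    rwa [map_add, map_smul, hwall y (hdual.subset hy.mem_dual) hy₀, add_left_inj] at hadd
  set c := ⟪p - σ p, z⟫ / ⟪p - σ p, p⟫ with hc
  have hz := hperp (z - c • p) <| by
    rw [inner_sub_right, real_inner_smul_right, hc, div_mul_cancel₀ _ hpos.ne', sub_self]
  rw [map_sub, map_smul, sub_eq_iff_eq_add] at hz
  rw [hz, smul_sub]
  abel

theorem inner_nonpos_of_isFacetPoint (hF : IsFundamentalDomain W F) (hp : p ∈ interior F)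
    (ht : t.Finite) (hdual : (PointedCone.dual (innerₗ V) t : Set V) = F)
    (htp : t ⊆ dirichletNormals W p) {u v y z : V} (hu : u ∈ t) (hv : v ∈ t) (huv : u ≠ v)
    (hy : IsFacetPoint (innerₗ V) t u y) (hz : IsFacetPoint (innerₗ V) t v z) : ⟪u, v⟫ ≤ 0 := by
  have hup := inner_pos_of_mem_dirichletNormals (htp hu)
  have hvp := inner_pos_of_mem_dirichletNormals (htp hv)
  obtain ⟨-, σ, hσ, rfl⟩ := htp hu
  obtain ⟨-, τ, hτ, rfl⟩ := htp hv
  have hσz := hF.apply_eq_sub_smul_of_isFacetPoint hp ht hdual hσ hy hup z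
  have hτy := hF.apply_eq_sub_smul_of_isFacetPoint hp ht hdual hτ hz hvp y
  set u := p - σ p
  set v := p - τ p
  set a := ⟪u, z⟫ / ⟪u, p⟫
  set b := ⟪v, y⟫ / ⟪v, p⟫
  have hab : 0 < a * b := mul_pos (div_pos (hz.2 u hu huv) hup) (div_pos (hy.2 v hv huv.symm) hvp)
  have hle : ⟪τ y, σ z⟫ ≤ ⟪y, z⟫ := by
    rw [inner_apply_left]
    exact hF.inner_apply_le (hdual.subset hy.mem_dual) (hdual.subset hz.mem_dual)
      (W.mul_mem (W.inv_mem hτ) hσ)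
  have hexpand : ⟪τ y, σ z⟫ = ⟪y, z⟫ + a * b * ⟪u, v⟫ := by
    have huy : ⟪y, u⟫ = 0 := real_inner_comm y u ▸ hy.1
    have hvz : ⟪v, z⟫ = 0 := hz.1
    rw [hσz, hτy]
    simp only [inner_sub_left, inner_sub_right, real_inner_smul_left, real_inner_smul_right, huy,
      hvz, real_inner_comm u v]
    ring
  nlinarith

end Facets

theorem exists_linearIndepOn_dual_eq (hF : IsFundamentalDomain W F) :
    ∃ s : Set V, s.Finite ∧ LinearIndepOn ℝ id s ∧
      (PointedCone.dual (innerₗ V) s : Set V) = F := by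
  obtain ⟨p, hp⟩ := hF.nonempty_interior
  obtain ⟨t, htp, ht, hfacet⟩ := exists_subset_dual_eq_forall_exists_isFacetPoint
    (p := innerₗ V) (finite_dirichletNormals p) fun _ => inner_pos_of_mem_dirichletNormals (W := W)
  have hfin : t.Finite := (finite_dirichletNormals p).subset htp
  have hdual : (PointedCone.dual (innerₗ V) t : Set V) = F :=
    ht ▸ hF.coe_dual_dirichletNormals hp
  choose! y hy using hfacet
  refine ⟨t, hfin, ?_, hdual⟩
  refine LinearMap.BilinForm.linearIndependent_of_pairwise_le_zero (innerₗ V)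
    (fun x hx => real_inner_self_pos.2 hx) ((innerₗ V).flip p) _
    (fun u => inner_pos_of_mem_dirichletNormals (htp u.2)) fun u v huv => ?_
  exact hF.inner_nonpos_of_isFacetPoint hp hfin hdual htp u.2 v.2 (Subtype.coe_ne_coe.2 huv)
    (hy u u.2) (hy v v.2)

theorem fixedSubmodule_eq_orthogonal_span (hF : IsFundamentalDomain W F) {s : Set V}
    (hdual : (PointedCone.dual (innerₗ V) s : Set V) = F) :
    fixedSubmodule W = (Submodule.span ℝ s)ᗮ := by
  ext x
  have horth : x ∈ (Submodule.span ℝ s)ᗮ ↔ ∀ u ∈ s, ⟪u, x⟫ = 0 := by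
    rw [← Submodule.span_singleton_le_iff_mem, ← Submodule.isOrtho_iff_le, Submodule.isOrtho_comm,
      Submodule.isOrtho_span]
    simp only [Set.mem_singleton_iff, forall_eq]
  simp only [hF.mem_fixedSubmodule_iff, ← hdual, SetLike.mem_coe, PointedCone.mem_dual, horth,
    map_neg, innerₗ_apply_apply, Left.nonneg_neg_iff, le_antisymm_iff (b := (0 : ℝ)), forall_and]
  exact and_comm

end IsFundamentalDomain

theorem mem_translate {σ : V ≃ₗᵢ[ℝ] V} {K : PointedCone ℝ V} {y : V} :
    y ∈ translate σ K ↔ σ⁻¹ y ∈ K := by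
  refine PointedCone.mem_map.trans ⟨?_, fun h => ⟨_, h, σ.apply_symm_apply y⟩⟩
  rintro ⟨x, hx, rfl⟩
  exact (σ.symm_apply_apply x).symm ▸ hx

theorem translate_mul (σ τ : V ≃ₗᵢ[ℝ] V) (K : PointedCone ℝ V) :
    translate (σ * τ) K = translate σ (translate τ K) := by
  ext x
  simp only [mem_translate, mul_inv_rev, LinearIsometryEquiv.coe_mul, Function.comp_apply]

theorem translate_inf (σ : V ≃ₗᵢ[ℝ] V) (K L : PointedCone ℝ V) :
    translate σ (K ⊓ L) = translate σ K ⊓ translate σ L := by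
  ext x
  simp only [mem_translate, Submodule.mem_inf]

namespace IsFundamentalDomain

variable {K : PointedCone ℝ V}

theorem coe_eq_iUnion_translate (hF : IsFundamentalDomain W F)
    (hC : ∀ σ ∈ W, ∀ x, σ x ∈ C ↔ x ∈ C) (hK : (K : Set V) = (C : Set V) ∩ F) :
    (C : Set V) = ⋃ σ ∈ W, (translate σ K : Set V) := by
  have hmem (x : V) : x ∈ K ↔ x ∈ C ∧ x ∈ F := Set.ext_iff.1 hK x
  ext x
  simp only [Set.mem_iUnion, SetLike.mem_coe, mem_translate, exists_prop, hmem]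
  constructor
  · intro hx
    obtain ⟨σ, hσ, hσx⟩ := hF.exists_apply_mem x
    exact ⟨σ⁻¹, W.inv_mem hσ, (hC _ (W.inv_mem (W.inv_mem hσ)) x).2 hx, (inv_inv σ).symm ▸ hσx⟩
  · rintro ⟨σ, hσ, hx, -⟩
    exact (hC _ (W.inv_mem hσ) x).1 hx

variable [Finite W]

theorem inf_translate_isFaceOf (hF : IsFundamentalDomain W F) (hK : (K : Set V) ⊆ F)
    {σ τ : V ≃ₗᵢ[ℝ] V} (hσ : σ ∈ W) (hτ : τ ∈ W) :
    (translate σ K ⊓ translate τ K).IsFaceOf (translate σ K) := by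
  have hface : ∀ ρ ∈ W, (K ⊓ translate ρ K).IsFaceOf K := by
    intro ρ hρ
    have hmem : ∀ x ∈ K, (x ∈ translate ρ K ↔ ρ⁻¹ x = x) := fun x hx => mem_translate.trans
      ⟨fun h => hF.apply_eq_self (W.inv_mem hρ) (hK hx) (hK h), fun h => h.symm ▸ hx⟩
    refine PointedCone.IsFaceOf.of_mem_of_add_mem_left inf_le_left fun {x y} hx hy hxy => ?_
    exact ⟨hx, (hmem x hx).2 (hF.apply_eq_self_of_apply_add (hK hx) (hK hy) (W.inv_mem hρ)
      ((hmem _ hxy.1).1 hxy.2))⟩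
  have h : (translate σ (K ⊓ translate (σ⁻¹ * τ) K)).IsFaceOf (translate σ K) :=
    (hface (σ⁻¹ * τ) (W.mul_mem (W.inv_mem hσ) hτ)).map_equiv σ.toLinearEquiv
  rwa [translate_inf, ← translate_mul, mul_inv_cancel_left] at h

theorem isTriangulation (hF : IsFundamentalDomain W F) (hK : (K : Set V) ⊆ F)
    (hsimp : K.IsSimplicial) (hunion : (C : Set V) = ⋃ σ ∈ W, (translate σ K : Set V)) :
    IsTriangulation C {G | ∃ σ ∈ W, G.IsFaceOf (translate σ K)} where
  finite := by
    refine (Set.finite_iUnion fun σ : W => finite_setOf_isFaceOf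
      (isSimplicial_map hsimp (σ : V ≃ₗᵢ[ℝ] V).injective)).subset ?_
    rintro G ⟨σ, hσ, hG⟩
    exact Set.mem_iUnion.2 ⟨⟨σ, hσ⟩, hG⟩
  simplicial := by
    rintro G ⟨σ, -, hG⟩
    exact isSimplicial_of_isFaceOf (isSimplicial_map hsimp σ.injective) hG
  face_mem := by
    rintro G ⟨σ, hσ, hG⟩ G' hG'
    exact ⟨σ, hσ, hG'.trans hG⟩
  inter_face := by
    rintro G ⟨σ, hσ, hG⟩ G' ⟨τ, hτ, hG'⟩
    have hinf := hG.inf hG'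
    have hleft := hinf.trans (hF.inf_translate_isFaceOf hK hσ hτ)
    have hright := hinf.trans (inf_comm (translate τ K) _ ▸ hF.inf_translate_isFaceOf hK hτ hσ)
    exact ⟨(hleft.isFaceOf_iff_le hG).2 inf_le_left, (hright.isFaceOf_iff_le hG').2 inf_le_right⟩
  union := by
    rw [hunion]
    refine Set.Subset.antisymm (Set.iUnion₂_subset fun σ hσ => ?_) (Set.iUnion₂_subset ?_)
    · exact Set.subset_biUnion_of_mem (u := fun G : PointedCone ℝ V => (G : Set V))
        (⟨σ, hσ, .refl _⟩ : translate σ K ∈ {G | ∃ σ ∈ W, G.IsFaceOf (translate σ K)})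
    · rintro G ⟨σ, hσ, hG⟩
      exact fun x hx => Set.mem_iUnion₂.2 ⟨σ, hσ, hG.le hx⟩

end IsFundamentalDomain

/-- The linear form `φ` cuts out the cone `C`: condition (1) of the theorem on its own. -/
def CutsOut (W : Subgroup (V ≃ₗᵢ[ℝ] V)) (φ : Module.Dual ℝ V) (C : PointedCone ℝ V) : Prop :=
  ∀ x, x ∈ C ↔ ∀ σ ∈ W, 0 ≤ φ (σ x)

namespace CutsOut

variable {φ : Module.Dual ℝ V}

theorem apply_mem_iff (hφ : CutsOut W φ C) {σ : V ≃ₗᵢ[ℝ] V} (hσ : σ ∈ W) (x : V) :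
    σ x ∈ C ↔ x ∈ C := by
  rw [hφ, hφ]
  refine ⟨fun h τ hτ => ?_, fun h τ hτ => h (τ * σ) (W.mul_mem hτ hσ)⟩
  simpa using h (τ * σ⁻¹) (W.mul_mem hτ (W.inv_mem hσ))

variable [Finite W] {xφ : V}

theorem mem_iff_inner_nonpos (hφ : CutsOut W φ C) (hF : IsFundamentalDomain W F)
    (hxφ : ∀ x, φ x = -⟪x, xφ⟫) {σ : V ≃ₗᵢ[ℝ] V} (hσ : σ ∈ W) (hσxφ : σ xφ ∈ F) {x : V}
    (hx : x ∈ F) : x ∈ C ↔ ⟪x, σ xφ⟫ ≤ 0 := by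
  have hφσ (τ : V ≃ₗᵢ[ℝ] V) : φ (τ x) = -⟪x, τ⁻¹ xφ⟫ := by rw [hxφ, inner_apply_left]
  simp only [hφ x, hφσ, Left.nonneg_neg_iff]
  refine ⟨fun h => inv_inv σ ▸ h σ⁻¹ (W.inv_mem hσ), fun h τ hτ => le_trans ?_ h⟩
  simpa using hF.inner_apply_le hx hσxφ (W.mul_mem (W.inv_mem hτ) (W.inv_mem hσ))

theorem coe_inter_eq (hφ : CutsOut W φ C) (hF : IsFundamentalDomain W F)
    (hxφ : ∀ x, φ x = -⟪x, xφ⟫) {σ : V ≃ₗᵢ[ℝ] V} (hσ : σ ∈ W) (hσxφ : σ xφ ∈ F) :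
    (C : Set V) ∩ F = {x | x ∈ F ∧ ⟪x, σ xφ⟫ ≤ 0} := by
  ext x
  exact and_comm.trans (and_congr_right (hφ.mem_iff_inner_nonpos hF hxφ hσ hσxφ))

end CutsOut

section FiniteDimensional

variable [FiniteDimensional ℝ V]

theorem isPerfPair_innerₗ : (innerₗ V).IsPerfPair := by
  have hinj : Function.Injective (innerₗ V) := fun x y h =>
    ext_inner_right ℝ fun z => LinearMap.congr_fun h z
  exact .of_injective hinj ((flip_innerₗ V).symm ▸ hinj)

theorem exists_eq_neg_inner (φ : Module.Dual ℝ V) : ∃ xφ : V, ∀ x, φ x = -⟪x, xφ⟫ := by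
  have := isPerfPair_innerₗ (V := V)
  refine ⟨-(innerₗ V).toPerfPair.symm φ, fun x => ?_⟩
  rw [inner_neg_right, neg_neg, real_inner_comm]
  exact (LinearMap.congr_fun ((innerₗ V).toPerfPair.apply_symm_apply φ) x).symm

theorem span_insert_eq_top {s : Set V} {x : V} (hs : Module.finrank ℝ (Submodule.span ℝ s)ᗮ = 1)
    (hx : x ∉ Submodule.span ℝ s) : Submodule.span ℝ (insert x s) = ⊤ := by
  have hlt : Submodule.span ℝ s < Submodule.span ℝ (insert x s) :=
    SetLike.lt_iff_le_and_exists.2 ⟨Submodule.span_mono (Set.subset_insert x s), x,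
      Submodule.subset_span (Set.mem_insert x s), hx⟩
  have hdim := (Submodule.span ℝ s).finrank_add_finrank_orthogonal
  have hlt' := Submodule.finrank_lt_finrank_of_lt hlt
  exact Submodule.eq_top_of_finrank_eq
    (le_antisymm (Submodule.finrank_le _) (by lia))

theorem CutsOut.exists_isSimplicial_inter [Finite W] {φ : Module.Dual ℝ V} (hφ : CutsOut W φ C)
    (hF : IsFundamentalDomain W F) (hfix : Module.finrank ℝ (fixedSubmodule W) = 1)
    (hker : ¬ fixedSubmodule W ≤ LinearMap.ker φ) :
    ∃ K : PointedCone ℝ V, (K : Set V) = (C : Set V) ∩ F ∧ K.IsSimplicial := by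
  obtain ⟨s, hs, hli, hdual⟩ := hF.exists_linearIndepOn_dual_eq
  have horth := hF.fixedSubmodule_eq_orthogonal_span hdual
  obtain ⟨xφ, hxφ⟩ := exists_eq_neg_inner φ
  obtain ⟨σ, hσ, hσxφ⟩ := hF.exists_apply_mem xφ
  obtain ⟨e, he, heφ⟩ := SetLike.not_le_iff_exists.1 hker
  have hnotin : -σ xφ ∉ Submodule.span ℝ s := by
    intro hmem
    have hzero : ⟪-σ xφ, e⟫ = 0 := Submodule.inner_right_of_mem_orthogonal hmem (horth ▸ he)
    rw [inner_neg_left, inner_apply_left, he _ (W.inv_mem hσ), real_inner_comm, ← hxφ] at hzero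
    exact heφ hzero
  have := isPerfPair_innerₗ (V := V)
  refine ⟨PointedCone.dual (innerₗ V) (insert (-σ xφ) s), ?_, isSimplicial_dual (hs.insert _)
    (hli.id_insert hnotin) (span_insert_eq_top (horth ▸ hfix) hnotin)⟩
  rw [hφ.coe_inter_eq hF hxφ hσ hσxφ, ← hdual]
  ext x
  simp [real_inner_comm, and_comm]

end FiniteDimensional

namespace IsAlmostIrreducible

variable {V₁ V₂ : Submodule ℝ V}

theorem inf_fixedSubmodule_eq_bot (hW : IsAlmostIrreducible W V₁ V₂) :
    V₁ ⊓ fixedSubmodule W = ⊥ := by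
  have hinv : IsInvariantSubspace W (V₁ ⊓ fixedSubmodule W) := fun σ hσ x hx =>
    (hx.2 σ hσ).symm ▸ hx
  refine (hW.irreducible _ inf_le_left hinv).resolve_right fun h => ?_
  obtain ⟨σ, hσ, x, hx, hne⟩ := hW.nontrivial
  exact hne (inf_eq_left.1 h hx σ hσ)

theorem fixedSubmodule_eq (hW : IsAlmostIrreducible W V₁ V₂) : fixedSubmodule W = V₂ := by
  have hle : V₂ ≤ fixedSubmodule W := fun x hx σ hσ => hW.trivial σ hσ x hx
  refine (eq_of_le_of_inf_le_of_sup_le hle (z := V₁) ?_ ?_).symm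
  · rw [inf_comm, hW.inf_fixedSubmodule_eq_bot]
    exact bot_le
  · rw [sup_comm V₂, hW.isCompl.sup_eq_top]
    exact le_top

end IsAlmostIrreducible

end ReflCone

theorem mainTheorem2_general {V : Type*} [NormedAddCommGroup V] [InnerProductSpace ℝ V]
    [FiniteDimensional ℝ V] (W : Subgroup (V ≃ₗᵢ[ℝ] V)) [Finite W]
    (hfix : Module.finrank ℝ (ReflCone.fixedSubmodule W) = 1)
    (C : PointedCone ℝ V) (φ : Module.Dual ℝ V) (hφ : ReflCone.CutsOut W φ C)
    (hker : ¬ ReflCone.fixedSubmodule W ≤ LinearMap.ker φ)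
    (F : Set V) (hF : ReflCone.IsFundamentalDomain W F) :
    ∃ Cplus : PointedCone ℝ V,
      (Cplus : Set V) = (C : Set V) ∩ F ∧
      Cplus.IsSimplicial ∧
      (∀ ψ : Module.Dual ℝ V, ReflCone.CutsOut W ψ C →
        ∀ xψ : V, (∀ x : V, ψ x = -inner ℝ x xψ) →
          ∃ x₀ : V, ReflCone.orbit W xψ ∩ F = {x₀} ∧
            (Cplus : Set V) = {x | x ∈ F ∧ inner ℝ x x₀ ≤ 0}) ∧
      (C : Set V) = (⋃ σ ∈ W, (ReflCone.translate σ Cplus : Set V)) ∧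
      ReflCone.IsTriangulation C
        {G | ∃ σ ∈ W, G.IsFaceOf (ReflCone.translate σ Cplus)} := by
  obtain ⟨K, hK, hsimp⟩ := hφ.exists_isSimplicial_inter hF hfix hker
  have hunion := hF.coe_eq_iUnion_translate (fun _ => hφ.apply_mem_iff) hK
  refine ⟨K, hK, hsimp, fun ψ hψ xψ hxψ => ?_, hunion,
    hF.isTriangulation (hK ▸ Set.inter_subset_right) hsimp hunion⟩
  obtain ⟨σ, hσ, hσxψ⟩ := hF.exists_apply_mem xψ
  exact ⟨σ xψ, hF.orbit_inter_eq_singleton hσ hσxψ, hK.trans (hψ.coe_inter_eq hF hxψ hσ hσxψ)⟩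

theorem mainTheorem2 {V : Type*} [NormedAddCommGroup V] [InnerProductSpace ℝ V]
    [FiniteDimensional ℝ V] (W : Subgroup (V ≃ₗᵢ[ℝ] V)) (V₁ V₂ : Submodule ℝ V)
    (hW : ReflCone.IsAlmostIrreducible W V₁ V₂)
    (C : PointedCone ℝ V) (hC : ReflCone.IsMonoconditional W V₁ V₂ C)
    (F : Set V) (hF : ReflCone.IsFundamentalDomain W F) :
    ∃ Cplus : PointedCone ℝ V,
      (Cplus : Set V) = (C : Set V) ∩ F ∧
      Cplus.IsSimplicial ∧
      (∀ φ : Module.Dual ℝ V, ReflCone.IsDefiningForm W V₁ V₂ C φ →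
        ∀ xφ : V, (∀ x : V, φ x = -inner ℝ x xφ) →
          ∃ x₀ : V, ReflCone.orbit W xφ ∩ F = {x₀} ∧
            (Cplus : Set V) = {x | x ∈ F ∧ inner ℝ x x₀ ≤ 0}) ∧
      (C : Set V) = (⋃ σ ∈ W, (ReflCone.translate σ Cplus : Set V)) ∧
      ReflCone.IsTriangulation C
        {G | ∃ σ ∈ W, G.IsFaceOf (ReflCone.translate σ Cplus)} := by
  have := hW.reflectionGroup.1
  obtain ⟨-, φ, hφ⟩ := hC
  obtain ⟨K, hK, hsimp, hforms, htri⟩ := mainTheorem2_general W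
    (hW.fixedSubmodule_eq ▸ hW.finrank_eq_one) C φ hφ.mem_iff
    (hW.fixedSubmodule_eq ▸ hφ.not_le_right) F hF
  exact ⟨K, hK, hsimp, fun ψ hψ => hforms ψ hψ.mem_iff, htri⟩
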